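/- Let $\mathcal R$ (resp. $\mathcal C$) be the Levi-Civita field: the set of functions $a:\mathbb Q\to\mathbb R$ (resp. $\mathbb C$), $q\mapsto a[q]$, whose support $\operatorname{supp}(a)=\{q: a[q]\neq 0\}$ is left-finite (for every $r\in\mathbb Q$ it has only finitely many elements smaller than $r$), with componentwise addition and the product $(ab)[q]=\sum_{q_a+q_b=q}a[q_a]\,b[q_b]$. Put $\lambda(a)=\min\operatorname{supp}(a)$ for $a\ne 0$ and $\lambda(0)=+\infty$; $a$ is at most finite if $\lambda(a)\ge 0$, and a vector is at most finite if all its entries are. The field $\mathcal R$ is ordered by: $a\succ 0$ iff $a\neq0$ and $a[\lambda(a)]>0$; square roots are taken with respect to this order. For $z=a+ib\in\mathcal C$ with $a,b\in\mathcal R$ put $|z|=\sqrt{a^2+b^2}\in\mathcal R$, and for $\mathbf x\in\mathcal C^n$ put $\|\mathbf x\|_2=\sqrt{|\mathbf x^1|^2+\dots+|\mathbf x^n|^2}\in\mathcal R$. For real $r$ put $\|a\|_r=\sup_{q\le r}|a[q]|$. A sequence $(a_k)$ in $\mathcal C$ converges weakly to $a\in\mathcal C$, written $a_k\xrightarrow{wk}a$,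 if for every real $r>0$ there is $N_0\in\mathbb N$ such that $\|a_k-a\|_{1/r}<r$ for all $k>N_0$; weak convergence of vectors is meant entrywise. Theorem 4.3 (power iteration with $\ell^2$-norm). Let $n\ge1$ and let $A\in\mathcal C^{n\times n}$ be diagonalizable, with eigenvalues $\nu_1,\dots,\nu_n$ (listed with multiplicity) that lie in $\mathcal R$, are at most finite and satisfy $$1=\nu_1[0]>|\nu_2[0]|\ge\dots\ge|\nu_n[0]|.$$ Let $\mathbf x\in\mathcal C^n$ have a representation $\mathbf x=\mathbf w_1+\dots+\mathbf w_n$ such that $A\mathbf w_j=\nu_j\mathbf w_j$ for all $j$ (where $\mathbf w_j=\mathbf 0$ is allowed for $j\ge 2$), all $\mathbf w_j$ are at most finite, and $\mathbf w_1[0]\ne\mathbf 0$, that is, $\mathbf w_1^i[0]\neq0$ for some $i$. Then, with $\mathbf x_k:=A^k\mathbf x$, $$\frac{\mathbf x_k}{\|\mathbf x_k\|_2}\xrightarrow{wk}\frac{\mathbf w_1}{\|\mathbf w_1\|_2}\qquad(k\to\infty).$$ -/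

import Mathlib

/-- A set of rational numbers is left-finite if, for every rational `r`, only finitely many of its
elements are smaller than `r`. -/
def LeftFinite (Q : Set ℚ) : Prop :=
  ∀ r : ℚ, {q ∈ Q | q < r}.Finite

namespace LeftFinite

theorem mono {s t : Set ℚ} (ht : LeftFinite t) (h : s ⊆ t) : LeftFinite s := fun r =>
  (ht r).subset fun _ hq => ⟨h hq.1, hq.2⟩

theorem empty : LeftFinite ∅ := fun _ => by simp

theorem singleton (a : ℚ) : LeftFinite {a} := fun r =>
  (Set.finite_singleton a).subset fun _ hq => hq.1

theorem union {s t : Set ℚ} (hs : LeftFinite s) (ht : LeftFinite t) : LeftFinite (s ∪ t) :=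
  fun r => ((hs r).union (ht r)).subset fun _ hq =>
    hq.1.elim (fun h => Or.inl ⟨h, hq.2⟩) (fun h => Or.inr ⟨h, hq.2⟩)

theorem bddBelow {s : Set ℚ} (hs : LeftFinite s) : ∃ m : ℚ, ∀ q ∈ s, m ≤ q := by
  obtain ⟨m, hm⟩ := (hs 0).bddBelow
  refine ⟨min m 0, fun q hq => ?_⟩
  by_cases h : q < 0
  · exact (min_le_left _ _).trans (hm ⟨hq, h⟩)
  · exact (min_le_right _ _).trans (not_lt.mp h)

open scoped Pointwise in
theorem add {s t : Set ℚ} (hs : LeftFinite s) (ht : LeftFinite t) : LeftFinite (s + t) := by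
  intro r
  obtain ⟨m, hm⟩ := hs.bddBelow
  obtain ⟨m', hm'⟩ := ht.bddBelow
  refine ((hs (r - m')).add (ht (r - m))).subset ?_
  rintro _ ⟨⟨a, ha, b, hb, rfl⟩, hr⟩
  have h1 := hm a ha
  have h2 := hm' b hb
  change a + b < r at hr
  exact ⟨a, ⟨ha, by linarith⟩, b, ⟨hb, by linarith⟩, rfl⟩

end LeftFinite

namespace HahnSeries

theorem leftFinite_mul {K : Type*} [Field K] {x y : HahnSeries ℚ K}
    (hx : LeftFinite x.support) (hy : LeftFinite y.support) : LeftFinite (x * y).support :=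
  (hx.add hy).mono support_mul_subset

theorem leftFinite_one {K : Type*} [Field K] : LeftFinite (1 : HahnSeries ℚ K).support :=
  (LeftFinite.singleton 0).mono support_single_subset

theorem leftFinite_pow {K : Type*} [Field K] {x : HahnSeries ℚ K}
    (hx : LeftFinite x.support) (n : ℕ) : LeftFinite (x ^ n).support := by
  induction n with
  | zero => rw [pow_zero]; exact leftFinite_one
  | succ n ih => rw [pow_succ]; exact leftFinite_mul ih hx

theorem le_of_mem_support_pow {K : Type*} [Field K] {x : HahnSeries ℚ K} {δ : ℚ}
    (hδ : ∀ q ∈ x.support, δ ≤ q) (n : ℕ) : ∀ q ∈ (x ^ n).support, n * δ ≤ q := by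
  induction n with
  | zero =>
    intro q hq
    rw [pow_zero] at hq
    have h : q = 0 := support_single_subset hq
    simp [h]
  | succ n ih =>
    intro q hq
    rw [pow_succ] at hq
    obtain ⟨a, ha, b, hb, rfl⟩ := support_mul_subset hq
    have h1 := ih a ha
    have h2 := hδ b hb
    push_cast
    change _ ≤ a + b
    linarith

theorem leftFinite_hsum_powers {K : Type*} [Field K] {x : HahnSeries ℚ K}
    (hx : LeftFinite x.support) : LeftFinite (SummableFamily.powers x).hsum.support := by
  by_cases h0 : 0 < x.orderTop
  · obtain ⟨δ, hδ, hδx⟩ : ∃ δ : ℚ, 0 < δ ∧ ∀ q ∈ x.support, δ ≤ q := by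
      rcases eq_or_ne x 0 with rfl | hx0
      · exact ⟨1, one_pos, by simp⟩
      · refine ⟨x.order, ?_, fun q hq => order_le_of_coeff_ne_zero hq⟩
        rw [← order_eq_orderTop_of_ne_zero hx0] at h0
        exact_mod_cast h0
    intro r
    obtain ⟨N, hN⟩ := exists_nat_gt (r / δ)
    refine ((Finset.range N).finite_toSet.biUnion
      (fun n _ => leftFinite_pow hx n r)).subset ?_
    rintro q ⟨hq, hqr⟩
    obtain ⟨n, hn⟩ := Set.mem_iUnion.1 (SummableFamily.support_hsum_subset hq)
    rw [SummableFamily.powers_of_orderTop_pos h0] at hn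
    have h1 := le_of_mem_support_pow hδx n q hn
    have h2 : (n : ℚ) < N := by
      refine lt_trans ?_ hN
      rw [lt_div_iff₀ hδ]
      linarith
    simp only [Set.mem_iUnion]
    exact ⟨n, by simpa using (by exact_mod_cast h2 : n < N), hn, hqr⟩
  · rw [SummableFamily.powers_of_not_orderTop_pos h0, SummableFamily.hsum_single]
    exact leftFinite_one

theorem leftFinite_inv {K : Type*} [Field K] {x : HahnSeries ℚ K}
    (hx : LeftFinite x.support) : LeftFinite (x⁻¹).support := by
  have hs : ∀ (a : ℚ) (c : K), LeftFinite (single a c : HahnSeries ℚ K).support := fun a c =>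
    (LeftFinite.singleton a).mono support_single_subset
  rw [inv_def]
  refine leftFinite_mul (hs _ _) (leftFinite_hsum_powers ?_)
  exact (leftFinite_one.union (leftFinite_mul (hs _ _) hx)).mono (support_sub_subset _ _)

end HahnSeries

/-- The Levi-Civita field with coefficients in `K`: all functions `a : ℚ → K` with left-finite
support, with componentwise addition and with the convolution product, as a subfield of the field of
Hahn series (a left-finite set is well-ordered). The value `a[q]` is `a.1.coeff q`. -/
noncomputable def LeviCivita (K : Type*) [Field K] : Subfield (HahnSeries ℚ K) where
  carrier := {a | LeftFinite a.support}
  zero_mem' := by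
    change LeftFinite (0 : HahnSeries ℚ K).support
    rw [HahnSeries.support_zero]
    exact LeftFinite.empty
  one_mem' := HahnSeries.leftFinite_one
  add_mem' hx hy := (LeftFinite.union hx hy).mono (HahnSeries.support_add_subset _ _)
  mul_mem' hx hy := HahnSeries.leftFinite_mul hx hy
  neg_mem' {x} hx := by
    change LeftFinite (-x).support
    rw [HahnSeries.support_neg]
    exact hx
  inv_mem' _ hx := HahnSeries.leftFinite_inv hx

namespace LeviCivita

/-- The value `a[q]`. -/
def coeff {K : Type*} [Field K] (a : LeviCivita K) (q : ℚ) : K :=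
  a.1.coeff q

/-- `a` is at most finite: `λ(a) ≥ 0`, where `λ(a)` is the minimum of the support of `a`
(and `⊤` for `a = 0`). -/
def AtMostFinite {K : Type*} [Field K] (a : LeviCivita K) : Prop :=
  0 ≤ a.1.orderTop

/-- The order of the real Levi-Civita field: `a` is positive if `a ≠ 0` and `a[λ(a)] > 0`
(the leading coefficient of `0` is `0`). -/
def IsPos (a : LeviCivita ℝ) : Prop :=
  0 < a.1.leadingCoeff

open scoped Classical in
/-- The square root of a nonnegative element of the real Levi-Civita field, that is, the unique
nonnegative element whose square is `a`. -/
noncomputable def sqrt (a : LeviCivita ℝ) : LeviCivita ℝ :=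
  if h : ∃ b : LeviCivita ℝ, (b = 0 ∨ IsPos b) ∧ b * b = a then h.choose else 0

/-- The embedding of the real into the complex Levi-Civita field. -/
noncomputable def ofReal (a : LeviCivita ℝ) : LeviCivita ℂ :=
  ⟨a.1.map Complex.ofRealHom, a.2.mono fun q hq h => hq (by simp_all)⟩

/-- The element `a` in the representation `z = a + i b` with `a`, `b` real. -/
noncomputable def re (z : LeviCivita ℂ) : LeviCivita ℝ :=
  ⟨z.1.map Complex.reAddGroupHom, z.2.mono fun q hq h => hq (by simp_all)⟩

/-- The element `b` in the representation `z = a + i b` with `a`, `b` real. -/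
noncomputable def im (z : LeviCivita ℂ) : LeviCivita ℝ :=
  ⟨z.1.map Complex.imAddGroupHom, z.2.mono fun q hq h => hq (by simp_all)⟩

/-- The absolute value `|z| = √(a² + b²)` of `z = a + i b`. -/
noncomputable def abs (z : LeviCivita ℂ) : LeviCivita ℝ :=
  sqrt (re z ^ 2 + im z ^ 2)

/-- The `ℓ²`-norm of a vector. -/
noncomputable def norm2 {n : ℕ} (x : Fin n → LeviCivita ℂ) : LeviCivita ℝ :=
  sqrt (∑ i, abs (x i) ^ 2)

/-- The seminorm `‖a‖_r = sup_{q ≤ r} |a[q]|`. The supremum is over a nonempty family with finitely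
many nonzero values, so it is attained. -/
noncomputable def seminorm (r : ℝ) (a : LeviCivita ℂ) : ℝ :=
  ⨆ q : {q : ℚ // (q : ℝ) ≤ r}, ‖coeff a q.1‖

/-- Weak convergence of a sequence. -/
def WeakTendsto (a : ℕ → LeviCivita ℂ) (l : LeviCivita ℂ) : Prop :=
  ∀ r : ℝ, 0 < r → ∃ N : ℕ, ∀ n > N, seminorm (1 / r) (a n - l) < r

/-- Weak convergence of a sequence of vectors, componentwise. -/
def VecWeakTendsto {n : ℕ} (a : ℕ → Fin n → LeviCivita ℂ) (l : Fin n → LeviCivita ℂ) : Prop :=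
  ∀ i, WeakTendsto (fun k => a k i) (l i)

/-- The matrix `A` is diagonalizable and `ν` lists its eigenvalues (with multiplicity):
`A` is similar to the diagonal matrix with entries `ν`. -/
def IsDiagonalizableWith {n : ℕ} (A : Matrix (Fin n) (Fin n) (LeviCivita ℂ))
    (ν : Fin n → LeviCivita ℂ) : Prop :=
  ∃ P : Matrix (Fin n) (Fin n) (LeviCivita ℂ), IsUnit P ∧ A = P * Matrix.diagonal ν * P⁻¹

end LeviCivita

/-! Dividing by `ν 0 ^ k` turns the iterate into `y k = ∑ j, (ν j / ν 0) ^ k • w j`. Since `ν 0` is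
positive, this leaves the normalized vector unchanged (`inv_norm2_smul_smul`). The term `j = 0` is
constant; the others vanish in the limit because `ν j / ν 0` has constant coefficient of modulus
less than 1 (`CoeffTendsto.pow_zero`).

Normalization must then be continuous, which coefficientwise limits alone do not give.
`CoeffTendsto` also asks that the supports eventually lie in one left-finite set of nonnegative
exponents. Each coefficient of a sum, product or power series value is then a finite expression
whose length does not depend on `k`, so limits pass through. The reciprocal norm is such a value: it
is the binomial series for exponent `-1/2` applied to the squared norm, whose constant coefficient
is positive in the limit. -/

open Filter Topology
open scoped Pointwise

/-! ### Left-finite sets of exponents and their multiples -/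

namespace LeftFinite

theorem isPWO {s : Set ℚ} (hs : LeftFinite s) : s.IsPWO := by
  rw [Set.isPWO_iff_isWF, Set.isWF_iff_no_descending_seq]
  intro f hf hfs
  refine Set.infinite_range_of_injective (f := fun n : ℕ => f (n + 1)) ?_ ?_
  · exact fun m n h => by simpa using hf.injective h
  · refine (hs (f 0)).subset ?_
    rintro _ ⟨n, rfl⟩
    exact ⟨hfs _, hf (Nat.succ_pos n)⟩

theorem exists_pos_le {s : Set ℚ} (hs : LeftFinite s) (hpos : ∀ q ∈ s, 0 < q) :
    ∃ δ : ℚ, 0 < δ ∧ ∀ q ∈ s, δ ≤ q := by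
  rcases s.eq_empty_or_nonempty with rfl | hne
  · exact ⟨1, one_pos, by simp⟩
  · exact ⟨hs.isPWO.isWF.min hne, hpos _ (hs.isPWO.isWF.min_mem hne),
      fun q hq => hs.isPWO.isWF.min_le hne hq⟩

theorem nsmul {s : Set ℚ} (hs : LeftFinite s) (n : ℕ) : LeftFinite (n • s) := by
  induction n with
  | zero => rw [zero_nsmul]; exact LeftFinite.singleton 0
  | succ n ih => rw [succ_nsmul]; exact ih.add hs

theorem nsmul_le_of_mem_nsmul {s : Set ℚ} {δ : ℚ} (hδ : ∀ q ∈ s, δ ≤ q) (n : ℕ) :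
    ∀ q ∈ n • s, n * δ ≤ q := by
  induction n with
  | zero => intro q hq; rw [zero_nsmul] at hq; simp [Set.mem_zero.1 hq]
  | succ n ih =>
    intro q hq
    rw [succ_nsmul] at hq
    obtain ⟨a, ha, b, hb, rfl⟩ := hq
    have h1 := ih a ha
    have h2 := hδ b hb
    push_cast
    change _ ≤ a + b
    linarith

/-- Elements of `n • s` are at least `n * δ`, so only finitely many `n` contribute below a given
bound. This set serves as a common support for all power series in elements supported in `s`. -/
theorem iUnion_nsmul {s : Set ℚ} (hs : LeftFinite s) (hpos : ∀ q ∈ s, 0 < q) :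
    LeftFinite (⋃ n : ℕ, n • s) := by
  obtain ⟨δ, hδ, hδs⟩ := hs.exists_pos_le hpos
  intro r
  obtain ⟨N, hN⟩ := exists_nat_gt (r / δ)
  refine ((Finset.range N).finite_toSet.biUnion (fun n _ => hs.nsmul n r)).subset ?_
  rintro q ⟨hq, hqr⟩
  obtain ⟨n, hn⟩ := Set.mem_iUnion.1 hq
  have h1 := nsmul_le_of_mem_nsmul hδs n q hn
  have h2 : (n : ℚ) < N := by
    refine lt_trans ?_ hN
    rw [lt_div_iff₀ hδ]
    linarith
  simp only [Set.mem_iUnion]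
  exact ⟨n, by simpa using (by exact_mod_cast h2 : n < N), hn, hqr⟩

end LeftFinite

/-! ### Coefficients as finite sums over fixed index sets -/

namespace HahnSeries

theorem support_pow_subset_nsmul {K : Type*} [Field K] {x : HahnSeries ℚ K} {s : Set ℚ}
    (hx : x.support ⊆ s) (n : ℕ) : (x ^ n).support ⊆ n • s := by
  induction n with
  | zero => rw [pow_zero, zero_nsmul]; exact support_single_subset
  | succ n ih =>
    rw [pow_succ, succ_nsmul]
    exact support_mul_subset.trans (Set.add_subset_add ih hx)

theorem orderTop_pos_of_le {K : Type*} [Field K] {x : HahnSeries ℚ K} {δ : ℚ} (hδ : 0 < δ)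
    (hx : ∀ q ∈ x.support, δ ≤ q) : 0 < x.orderTop := by
  refine lt_of_lt_of_le (b := (δ : WithTop ℚ)) (by exact_mod_cast hδ) ?_
  rw [le_orderTop_iff_forall]
  intro j hj
  by_contra h
  exact absurd (hx j h) (not_le.2 (by exact_mod_cast hj))

/-- The `n`-th power has no exponent below `n * δ`. The cutoff `N` depends only on `q` and `δ`, so
it serves a whole sequence of arguments and power series at once. -/
theorem coeff_heval_eq_sum_range {K : Type*} [Field K] {x : HahnSeries ℚ K} {δ : ℚ} (hδ : 0 < δ)
    (hx : ∀ q ∈ x.support, δ ≤ q) (f : PowerSeries K) {q : ℚ} {N : ℕ} (hN : q < N * δ) :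
    (PowerSeries.heval x f).coeff q
      = ∑ n ∈ Finset.range N, PowerSeries.coeff n f * (x ^ n).coeff q := by
  have hpos := orderTop_pos_of_le hδ hx
  have h : ∀ n, ((SummableFamily.powerSeriesFamily x f).coeff q) n
      = PowerSeries.coeff n f * (x ^ n).coeff q := fun n => by
    rw [SummableFamily.coeff_apply, SummableFamily.powerSeriesFamily_of_orderTop_pos hpos]
    simp
  rw [PowerSeries.coeff_heval, finsum_congr h]
  refine finsum_eq_sum_of_support_subset _ fun n hn => ?_
  have h1 := le_of_mem_support_pow hx n q (right_ne_zero_of_mul hn)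
  have h2 : (n : ℚ) < N := lt_of_mul_lt_mul_right (h1.trans_lt hN) hδ.le
  simpa using (by exact_mod_cast h2 : n < N)

theorem coeff_mul_of_support_subset {K : Type*} [Field K] {x y : HahnSeries ℚ K} {s t : Set ℚ}
    (hs : s.IsPWO) (ht : t.IsPWO) (hx : x.support ⊆ s) (hy : y.support ⊆ t) (q : ℚ) :
    (x * y).coeff q = ∑ ij ∈ Finset.antidiagonal hs ht q, x.coeff ij.1 * y.coeff ij.2 := by
  rw [coeff_mul]
  refine Finset.sum_subset_zero_on_sdiff (fun ij hij => ?_) (fun ij hij => ?_) fun _ _ => rfl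
  · rw [Finset.mem_antidiagonal] at hij ⊢
    exact ⟨hx hij.1, hy hij.2.1, hij.2.2⟩
  · rw [Finset.mem_sdiff, Finset.mem_antidiagonal, Finset.mem_antidiagonal] at hij
    by_contra h
    exact hij.2 ⟨left_ne_zero_of_mul h, right_ne_zero_of_mul h, hij.1.2.2⟩

/-- Coefficientwise convergence of a sequence of Hahn series whose supports eventually lie in a
common left-finite set of nonnegative exponents. -/
def CoeffTendsto {K : Type*} [NormedField K] (a : ℕ → HahnSeries ℚ K) (l : HahnSeries ℚ K) : Prop :=
  ∃ s : Set ℚ, LeftFinite s ∧ (∀ q ∈ s, 0 ≤ q) ∧ (∀ᶠ k in atTop, (a k).support ⊆ s) ∧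
    ∀ q, Tendsto (fun k => (a k).coeff q) atTop (𝓝 (l.coeff q))

/-! ### Closure properties of coefficientwise convergence -/

namespace CoeffTendsto

variable {K : Type*} [NormedField K] {a b : ℕ → HahnSeries ℚ K} {l m : HahnSeries ℚ K}

theorem support_subset_of_eventually {s : Set ℚ} (hs : ∀ᶠ k in atTop, (a k).support ⊆ s)
    (h : ∀ q, Tendsto (fun k => (a k).coeff q) atTop (𝓝 (l.coeff q))) : l.support ⊆ s := by
  intro q hq
  by_contra hqs
  refine hq (tendsto_nhds_unique (h q) (tendsto_const_nhds.congr' ?_))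
  filter_upwards [hs] with k hk
  by_contra h0
  exact hqs (hk fun h => h0 h.symm)

theorem leftFinite_support (h : CoeffTendsto a l) : LeftFinite l.support := by
  obtain ⟨s, hs, -, ha, hl⟩ := h
  exact hs.mono (support_subset_of_eventually ha hl)

theorem tendsto_coeff (h : CoeffTendsto a l) (q : ℚ) :
    Tendsto (fun k => (a k).coeff q) atTop (𝓝 (l.coeff q)) := by
  obtain ⟨s, -, -, -, hl⟩ := h
  exact hl q

theorem congr' (h : CoeffTendsto a l) (hab : ∀ᶠ k in atTop, a k = b k) : CoeffTendsto b l := by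
  obtain ⟨s, hs, hs0, ha, hl⟩ := h
  refine ⟨s, hs, hs0, ?_, fun q => (hl q).congr' ?_⟩
  · filter_upwards [ha, hab] with k h1 h2
    rwa [← h2]
  · filter_upwards [hab] with k h2
    rw [h2]

theorem const (hl : LeftFinite l.support) (h0 : 0 ≤ l.orderTop) : CoeffTendsto (fun _ => l) l := by
  refine ⟨l.support, hl, fun q hq => ?_, .of_forall fun _ => subset_rfl,
    fun q => tendsto_const_nhds⟩
  exact_mod_cast h0.trans (orderTop_le_of_coeff_ne_zero hq)

theorem single_zero {c : ℕ → K} {d : K} (h : Tendsto c atTop (𝓝 d)) :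
    CoeffTendsto (fun k => single 0 (c k)) (single 0 d) := by
  refine ⟨{0}, LeftFinite.singleton 0, by simp, .of_forall fun _ => support_single_subset,
    fun q => ?_⟩
  by_cases hq : q = 0
  · subst hq; simpa using h
  · simp [coeff_single_of_ne hq]

theorem add (ha : CoeffTendsto a l) (hb : CoeffTendsto b m) :
    CoeffTendsto (fun k => a k + b k) (l + m) := by
  obtain ⟨s, hs, hs0, ha, hl⟩ := ha
  obtain ⟨t, ht, ht0, hb, hm⟩ := hb
  refine ⟨s ∪ t, hs.union ht, fun q hq => hq.elim (hs0 q) (ht0 q), ?_, fun q => ?_⟩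
  · filter_upwards [ha, hb] with k h1 h2
    exact (support_add_subset _ _).trans (Set.union_subset_union h1 h2)
  · simpa using (hl q).add (hm q)

theorem sum {ι : Type*} (t : Finset ι) {a : ι → ℕ → HahnSeries ℚ K} {l : ι → HahnSeries ℚ K}
    (h : ∀ i ∈ t, CoeffTendsto (a i) (l i)) :
    CoeffTendsto (fun k => ∑ i ∈ t, a i k) (∑ i ∈ t, l i) := by
  classical
  induction t using Finset.induction_on with
  | empty =>
    simpa using const (l := (0 : HahnSeries ℚ K)) (by simpa using LeftFinite.empty) (by simp)
  | insert i t hi ih =>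
    simp only [Finset.sum_insert hi]
    exact (h i (by simp)).add (ih fun j hj => h j (by simp [hj]))

theorem mul (ha : CoeffTendsto a l) (hb : CoeffTendsto b m) :
    CoeffTendsto (fun k => a k * b k) (l * m) := by
  obtain ⟨s, hs, hs0, ha, hl⟩ := ha
  obtain ⟨t, ht, ht0, hb, hm⟩ := hb
  refine ⟨s + t, hs.add ht, ?_, ?_, fun q => ?_⟩
  · rintro _ ⟨x, hx, y, hy, rfl⟩
    exact add_nonneg (hs0 x hx) (ht0 y hy)
  · filter_upwards [ha, hb] with k h1 h2
    exact support_mul_subset.trans (Set.add_subset_add h1 h2)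
  · rw [coeff_mul_of_support_subset hs.isPWO ht.isPWO (support_subset_of_eventually ha hl)
      (support_subset_of_eventually hb hm)]
    refine (tendsto_finsetSum _ fun ij _ => (hl ij.1).mul (hm ij.2)).congr' ?_
    filter_upwards [ha, hb] with k h1 h2
    rw [coeff_mul_of_support_subset hs.isPWO ht.isPWO h1 h2]

theorem pow (ha : CoeffTendsto a l) (n : ℕ) : CoeffTendsto (fun k => a k ^ n) (l ^ n) := by
  induction n with
  | zero => simpa using const (K := K) leftFinite_one (by simp)
  | succ n ih => simpa only [pow_succ] using ih.mul ha

theorem map {L : Type*} [NormedField L] (f : K →+ L) (hf : Continuous f)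
    (ha : CoeffTendsto a l) : CoeffTendsto (fun k => (a k).map f) (l.map f) := by
  obtain ⟨s, hs, hs0, ha, hl⟩ := ha
  refine ⟨s, hs, hs0, ?_, fun q => ?_⟩
  · filter_upwards [ha] with k hk q hq
    exact hk fun h => hq (by simp [h])
  · exact (hf.tendsto _).comp (hl q)

/-- Both the argument and the power series may vary: inverse square roots need the first, powers
with a nonzero constant coefficient the second. -/
theorem heval (ha : CoeffTendsto a l) (h0 : ∀ᶠ k in atTop, (a k).coeff 0 = 0)
    {f : ℕ → PowerSeries K} {g : PowerSeries K}
    (hf : ∀ n, Tendsto (fun k => PowerSeries.coeff n (f k)) atTop (𝓝 (PowerSeries.coeff n g))) :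
    CoeffTendsto (fun k => PowerSeries.heval (a k) (f k)) (PowerSeries.heval l g) := by
  have hpow := fun n => (ha.pow n).tendsto_coeff
  obtain ⟨s, hs, hs0, ha, hl⟩ := ha
  have hs' : LeftFinite (s \ {0}) := hs.mono Set.sdiff_subset
  have hpos : ∀ q ∈ s \ {0}, 0 < q := fun q hq => lt_of_le_of_ne (hs0 q hq.1) (Ne.symm hq.2)
  -- With the exponent 0 gone, left-finiteness gives a gap `δ > 0` valid for all large `k`.
  have ha' : ∀ᶠ k in atTop, (a k).support ⊆ s \ {0} := by
    filter_upwards [ha, h0] with k h1 h2 q hq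
    exact ⟨h1 hq, fun h => hq (by rw [Set.mem_singleton_iff.1 h, h2])⟩
  obtain ⟨δ, hδ, hδs⟩ := hs'.exists_pos_le hpos
  refine ⟨⋃ n : ℕ, n • (s \ {0}), hs'.iUnion_nsmul hpos, fun q hq => ?_, ?_, fun q => ?_⟩
  · obtain ⟨n, hn⟩ := Set.mem_iUnion.1 hq
    exact le_trans (by positivity) (LeftFinite.nsmul_le_of_mem_nsmul hδs n q hn)
  · filter_upwards [ha'] with k hk q hq
    obtain ⟨N, hN⟩ := exists_nat_gt (q / δ)
    rw [mem_support, coeff_heval_eq_sum_range hδ (fun q hq => hδs q (hk hq)) _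
      ((div_lt_iff₀ hδ).1 hN)] at hq
    obtain ⟨n, -, hn⟩ := Finset.exists_ne_zero_of_sum_ne_zero hq
    exact Set.mem_iUnion.2 ⟨n, support_pow_subset_nsmul hk n (right_ne_zero_of_mul hn)⟩
  · obtain ⟨N, hN⟩ := exists_nat_gt (q / δ)
    have hN' := (div_lt_iff₀ hδ).1 hN
    have hl' := support_subset_of_eventually ha' hl
    rw [coeff_heval_eq_sum_range hδ (fun q hq => hδs q (hl' hq)) _ hN']
    refine (tendsto_finsetSum _ fun n _ => (hf n).mul (hpow n q)).congr' ?_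
    filter_upwards [ha'] with k hk
    rw [coeff_heval_eq_sum_range hδ (fun q hq => hδs q (hk hq)) _ hN']

end CoeffTendsto

end HahnSeries

namespace HahnSeries

/-! ### Constant coefficients of series with nonnegative exponents -/

section Nonneg

variable {K : Type*} [Field K] {x y : HahnSeries ℚ K}

theorem zero_le_orderTop_iff_support : 0 ≤ x.orderTop ↔ ∀ q ∈ x.support, 0 ≤ q := by
  rw [le_orderTop_iff_forall]
  refine ⟨fun h q hq => ?_, fun h q hq => ?_⟩
  · by_contra hlt
    exact hq (h q (by exact_mod_cast not_le.1 hlt))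
  · by_contra h0
    exact absurd (h q h0) (not_le.2 (by exact_mod_cast hq))

theorem orderTop_eq_zero (hx : 0 ≤ x.orderTop) (h0 : x.coeff 0 ≠ 0) : x.orderTop = 0 :=
  le_antisymm (by exact_mod_cast orderTop_le_of_coeff_ne_zero h0) hx

theorem orderTop_pos (hx : 0 ≤ x.orderTop) (h0 : x.coeff 0 = 0) : 0 < x.orderTop :=
  lt_of_le_of_ne hx fun h => coeff_orderTop_ne (g := 0) (by exact_mod_cast h.symm) h0

theorem leadingCoeff_eq_coeff_zero (hx : 0 ≤ x.orderTop) (h0 : x.coeff 0 ≠ 0) :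
    x.leadingCoeff = x.coeff 0 := by
  have hx0 : x ≠ 0 := by rintro rfl; simp at h0
  have h1 : x.order = 0 := by
    have := order_eq_orderTop_of_ne_zero hx0
    rw [orderTop_eq_zero hx h0] at this
    exact_mod_cast this
  rw [leadingCoeff_eq, h1]

theorem coeff_zero_mul (hx : 0 ≤ x.orderTop) (hy : 0 ≤ y.orderTop) :
    (x * y).coeff 0 = x.coeff 0 * y.coeff 0 := by
  rw [zero_le_orderTop_iff_support] at hx hy
  rw [coeff_mul, Finset.sum_eq_single (0, 0)]
  · rintro ⟨i, j⟩ hij hne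
    rw [Finset.mem_antidiagonal] at hij
    obtain ⟨hi, hj, h⟩ := hij
    have := hx i hi
    have := hy j hj
    simp only at h
    exact absurd (Prod.ext (by simp; linarith) (by simp; linarith)) hne
  · intro h
    by_contra hne
    exact h (Finset.mem_antidiagonal.2
      ⟨left_ne_zero_of_mul hne, right_ne_zero_of_mul hne, add_zero 0⟩)

end Nonneg

namespace CoeffTendsto

variable {K : Type*} [NormedField K] {a : ℕ → HahnSeries ℚ K} {l : HahnSeries ℚ K}

theorem eventually_zero_le_orderTop (h : CoeffTendsto a l) : ∀ᶠ k in atTop, 0 ≤ (a k).orderTop := by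
  obtain ⟨s, -, hs0, ha, -⟩ := h
  filter_upwards [ha] with k hk
  exact zero_le_orderTop_iff_support.2 fun q hq => hs0 q (hk hq)

theorem zero_le_orderTop (h : CoeffTendsto a l) : 0 ≤ l.orderTop := by
  obtain ⟨s, -, hs0, ha, hl⟩ := h
  exact zero_le_orderTop_iff_support.2 fun q hq => hs0 q (support_subset_of_eventually ha hl hq)

end CoeffTendsto

/-- The inverse square root of a series with nonnegative exponents and positive constant
coefficient, given by the binomial series. -/
noncomputable def rsqrt (a : HahnSeries ℚ ℝ) : HahnSeries ℚ ℝ :=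
  single 0 (√(a.coeff 0))⁻¹ * PowerSeries.heval (single 0 (a.coeff 0)⁻¹ * a + single 0 (-1))
    (PowerSeries.binomialSeries ℝ (-1 / 2 : ℝ))

theorem CoeffTendsto.rsqrt {a : ℕ → HahnSeries ℚ ℝ} {l : HahnSeries ℚ ℝ} (h : CoeffTendsto a l)
    (h0 : 0 < l.coeff 0) : CoeffTendsto (fun k => rsqrt (a k)) (rsqrt l) := by
  have hc := h.tendsto_coeff 0
  refine (single_zero ((Real.continuous_sqrt.tendsto _ |>.comp hc).inv₀
    (Real.sqrt_pos.2 h0).ne')).mul (heval ?_ ?_ fun n => tendsto_const_nhds)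
  · exact ((single_zero (hc.inv₀ h0.ne')).mul h).add (single_zero tendsto_const_nhds)
  · filter_upwards [hc.eventually_const_lt h0] with k hk
    rw [coeff_add, coeff_single_zero_mul, coeff_single_same, inv_mul_cancel₀ hk.ne']
    norm_num

/-! ### Square roots from the binomial series -/

section rsqrt

variable {a : HahnSeries ℚ ℝ}

/-- Write `a = c * (1 + u)` with `u` of positive order. Binomial series multiply by adding
exponents, and `-1/2 - 1/2 + 1 = 0`. -/
theorem rsqrt_mul_rsqrt_mul (ha : 0 ≤ a.orderTop) (h0 : 0 < a.coeff 0) :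
    rsqrt a * rsqrt a * a = 1 := by
  set c := a.coeff 0 with hc
  set u : HahnSeries ℚ ℝ := single 0 c⁻¹ * a + single 0 (-1) with hu
  have hu0 : 0 < u.orderTop := by
    refine orderTop_pos ?_ ?_
    · refine le_trans (le_min ?_ ?_) min_orderTop_le_orderTop_add
      · exact (add_nonneg (by exact_mod_cast orderTop_single_le) ha).trans orderTop_add_le_mul
      · exact_mod_cast orderTop_single_le
    · rw [hu, coeff_add, coeff_single_zero_mul, coeff_single_same, inv_mul_cancel₀ h0.ne']
      norm_num
  set B := PowerSeries.heval u (PowerSeries.binomialSeries ℝ (-1 / 2 : ℝ)) with hB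
  have hBB : B * B * (1 + u) = 1 := by
    have h1 : (1 : HahnSeries ℚ ℝ) + u = PowerSeries.heval u (1 + PowerSeries.X) := by
      rw [map_add, map_one, PowerSeries.heval_X u hu0]
    have h2 : (1 + PowerSeries.X : PowerSeries ℝ)
        = PowerSeries.binomialSeries ℝ ((1 : ℕ) : ℝ) := by
      rw [PowerSeries.binomialSeries_nat, pow_one]
    rw [h1, h2, hB, ← map_mul, ← map_mul, ← PowerSeries.binomialSeries_add,
      ← PowerSeries.binomialSeries_add,
      show (-1 / 2 + -1 / 2 + ((1 : ℕ) : ℝ) : ℝ) = 0 by norm_num, PowerSeries.binomialSeries_zero,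
      map_one]
  have h1u : 1 + u = single 0 c⁻¹ * a := by
    have : single (0 : ℚ) (-1 : ℝ) = -1 := by rw [← single_zero_one, single_neg]
    rw [hu, this]; ring
  have hs : (single 0 (√c)⁻¹ : HahnSeries ℚ ℝ) * single 0 (√c)⁻¹ = single 0 c⁻¹ := by
    rw [single_mul_single, add_zero, ← mul_inv, Real.mul_self_sqrt h0.le]
  calc rsqrt a * rsqrt a * a
      = B * B * ((single 0 (√c)⁻¹ * single 0 (√c)⁻¹) * a) := by
        change single 0 (√c)⁻¹ * B * (single 0 (√c)⁻¹ * B) * a = _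
        ring
    _ = 1 := by rw [hs, ← h1u, hBB]

theorem leadingCoeff_rsqrt_pos (hf : LeftFinite a.support) (ha : 0 ≤ a.orderTop)
    (h0 : 0 < a.coeff 0) : 0 < (rsqrt a).leadingCoeff := by
  have h := ((CoeffTendsto.const hf ha).rsqrt h0).zero_le_orderTop
  have h1 : 0 < (rsqrt a).coeff 0 := by
    rw [rsqrt, coeff_single_zero_mul, PowerSeries.coeff_heval_zero,
      PowerSeries.binomialSeries_constantCoeff, mul_one]
    exact inv_pos.2 (Real.sqrt_pos.2 h0)
  rwa [leadingCoeff_eq_coeff_zero h h1.ne']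

/-- A monomial factor shifts `a` to order 0, where `rsqrt d * d` is a root of `d`; shifting back by
half the order is possible because exponents are rational. -/
theorem exists_mul_self_eq (hf : LeftFinite a.support) (ha : 0 < a.leadingCoeff) :
    ∃ b : HahnSeries ℚ ℝ, LeftFinite b.support ∧ 0 < b.leadingCoeff ∧ b * b = a := by
  have hs : ∀ (q : ℚ) (c : ℝ), LeftFinite (single q c : HahnSeries ℚ ℝ).support := fun q c =>
    (LeftFinite.singleton q).mono support_single_subset
  have ha0 : a ≠ 0 := by rintro rfl; simp at ha
  set d : HahnSeries ℚ ℝ := single (-a.order) 1 * a with hd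
  have hdf : LeftFinite d.support := leftFinite_mul (hs _ _) hf
  have hdc : d.coeff 0 = a.leadingCoeff := by
    rw [hd, coeff_single_mul, leadingCoeff_eq]; simp
  have hdo : 0 ≤ d.orderTop := by
    rw [hd, orderTop_mul, orderTop_single one_ne_zero, ← order_eq_orderTop_of_ne_zero ha0,
      ← WithTop.coe_add, neg_add_cancel]
    simp
  have hd0 : 0 < d.coeff 0 := hdc ▸ ha
  have hdl : 0 < d.leadingCoeff := by rwa [leadingCoeff_eq_coeff_zero hdo hd0.ne']
  refine ⟨single (a.order / 2) 1 * (rsqrt d * d), leftFinite_mul (hs _ _) (leftFinite_mul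
    ((CoeffTendsto.const hdf hdo).rsqrt hd0).leftFinite_support hdf), ?_, ?_⟩
  · rw [leadingCoeff_mul, leadingCoeff_mul, leadingCoeff_of_single, one_mul]
    exact mul_pos (leadingCoeff_rsqrt_pos hdf hdo hd0) hdl
  · calc single (a.order / 2) 1 * (rsqrt d * d) * (single (a.order / 2) 1 * (rsqrt d * d))
        = (single (a.order / 2) 1 * single (a.order / 2) 1) * (rsqrt d * rsqrt d * d) * d := by ring
      _ = single a.order 1 * (single (-a.order) 1 * a) := by
        rw [rsqrt_mul_rsqrt_mul hdo hd0, mul_one, single_mul_single, add_halves, mul_one]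
      _ = a := by
        rw [← mul_assoc, single_mul_single, add_neg_cancel, mul_one, single_zero_one, one_mul]

end rsqrt

/-- Split `a = c + u` with `u` of positive order. Then `a ^ k` is the value at the fixed `u` of `(X
+ c) ^ k`, whose `n`-th coefficient `c ^ (k - n) * k.choose n` tends to 0 as `‖c‖ < 1`. -/
theorem CoeffTendsto.pow_zero {K : Type*} [NormedField K] [CompleteSpace K] {a : HahnSeries ℚ K}
    (hf : LeftFinite a.support) (ha : 0 ≤ a.orderTop) (h : ‖a.coeff 0‖ < 1) :
    CoeffTendsto (fun k => a ^ k) 0 := by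
  set c := a.coeff 0 with hc
  set u : HahnSeries ℚ K := a + single 0 (-c) with hu
  have hs : LeftFinite (single 0 (-c) : HahnSeries ℚ K).support :=
    (LeftFinite.singleton 0).mono support_single_subset
  have hu0 : u.coeff 0 = 0 := by rw [hu, coeff_add, coeff_single_same]; simp [hc]
  have huo : 0 ≤ u.orderTop :=
    le_trans (le_min ha (by exact_mod_cast orderTop_single_le)) min_orderTop_le_orderTop_add
  have hau : a = PowerSeries.heval u (PowerSeries.X + PowerSeries.C c) := by
    rw [map_add, PowerSeries.heval_X u (orderTop_pos huo hu0), PowerSeries.heval_C, hu, single_neg,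
      ← single_zero_mul_eq_smul]
    simp
  have key := (const ((hf.union hs).mono (support_add_subset _ _)) huo).heval
    (.of_forall fun _ => hu0) (f := fun k => (PowerSeries.X + PowerSeries.C c) ^ k) (g := 0)
    fun n => ?_
  · rw [map_zero] at key
    refine key.congr' (.of_forall fun k => ?_)
    rw [map_pow, ← hau]
  · have hcoe : ∀ k, PowerSeries.coeff n ((PowerSeries.X + PowerSeries.C c) ^ k)
        = c ^ (k - n) * (k.choose n : K) := fun k => by
      rw [← Polynomial.coeff_X_add_C_pow, ← Polynomial.coeff_coe]
      simp
    simp only [hcoe, map_zero]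
    -- Replacing `k` by `k + n` removes the truncated subtraction and leaves the terms of a summable
    -- series.
    rw [← tendsto_add_atTop_iff_nat n]
    simpa [mul_comm] using
      (summable_choose_mul_geometric_of_norm_lt_one n h).tendsto_atTop_zero

end HahnSeries

/-! ### Order, square roots and the norm -/

namespace LeviCivita

theorem isPos_iff {a : LeviCivita ℝ} : IsPos a ↔ 0 < toLex a.1 :=
  HahnSeries.leadingCoeff_pos_iff (x := toLex a.1)

theorem eq_zero_or_isPos_iff {a : LeviCivita ℝ} : a = 0 ∨ IsPos a ↔ 0 ≤ toLex a.1 := by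
  rw [isPos_iff, le_iff_lt_or_eq, or_comm]
  refine or_congr_right ⟨fun h => by rw [h]; rfl, fun h => Subtype.ext h.symm⟩

theorem IsPos.ne_zero {a : LeviCivita ℝ} (h : IsPos a) : a ≠ 0 := by
  rintro rfl
  simp [IsPos] at h

theorem IsPos.mul {a b : LeviCivita ℝ} (ha : IsPos a) (hb : IsPos b) : IsPos (a * b) := by
  unfold IsPos at *
  rw [Subfield.coe_mul, HahnSeries.leadingCoeff_mul]
  exact mul_pos ha hb

theorem IsPos.pow {a : LeviCivita ℝ} (ha : IsPos a) (n : ℕ) : IsPos (a ^ n) := by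
  induction n with
  | zero => rw [pow_zero]; simp [IsPos]
  | succ n ih => rw [pow_succ]; exact ih.mul ha

/-- Two roots agree up to sign, and opposite nonnegative elements are both 0; hence the chosen root
is `b`. -/
theorem sqrt_eq {a b : LeviCivita ℝ} (hb : b = 0 ∨ IsPos b) (h : b * b = a) : sqrt a = b := by
  have hex : ∃ b : LeviCivita ℝ, (b = 0 ∨ IsPos b) ∧ b * b = a := ⟨b, hb, h⟩
  rw [sqrt, dif_pos hex]
  obtain ⟨h1, h2⟩ := hex.choose_spec
  rw [eq_zero_or_isPos_iff] at h1 hb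
  refine (mul_self_eq_mul_self_iff.1 (h2.trans h.symm)).elim id fun h3 => ?_
  have h4 : toLex b.1 = 0 := by
    rw [h3] at h1
    exact le_antisymm (neg_nonneg.1 h1) hb
  have h5 : b = 0 := Subtype.ext h4
  rw [h3, h5, neg_zero]

theorem sqrt_spec {a : LeviCivita ℝ} (ha : a = 0 ∨ IsPos a) :
    (sqrt a = 0 ∨ IsPos (sqrt a)) ∧ sqrt a * sqrt a = a := by
  have hex : ∃ b : LeviCivita ℝ, (b = 0 ∨ IsPos b) ∧ b * b = a := by
    rcases ha with rfl | ha
    · exact ⟨0, Or.inl rfl, mul_zero 0⟩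
    · obtain ⟨b, hb, hb0, h⟩ := HahnSeries.exists_mul_self_eq a.2 ha
      exact ⟨⟨b, hb⟩, Or.inr hb0, Subtype.ext h⟩
  rw [sqrt, dif_pos hex]
  exact hex.choose_spec

theorem sum_sq_add_sq_nonneg {ι : Type*} (s : Finset ι) (a b : ι → LeviCivita ℝ) :
    ∑ i ∈ s, (a i ^ 2 + b i ^ 2) = 0 ∨ IsPos (∑ i ∈ s, (a i ^ 2 + b i ^ 2)) := by
  rw [eq_zero_or_isPos_iff]
  have : toLex (∑ i ∈ s, (a i ^ 2 + b i ^ 2)).1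
      = ∑ i ∈ s, (toLex (a i).1 ^ 2 + toLex (b i).1 ^ 2) := by
    rw [← Subfield.subtype_apply, map_sum]
    rfl
  rw [this]
  exact Finset.sum_nonneg fun i _ => add_nonneg (sq_nonneg _) (sq_nonneg _)

theorem abs_sq (z : LeviCivita ℂ) : abs z ^ 2 = re z ^ 2 + im z ^ 2 := by
  have h := sum_sq_add_sq_nonneg {()} (fun _ => re z) (fun _ => im z)
  rw [Finset.sum_singleton] at h
  rw [abs, sq, (sqrt_spec h).2]

/-- The square of the `ℓ²`-norm, as a polynomial in the real and imaginary parts. -/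
noncomputable def normSq {n : ℕ} (x : Fin n → LeviCivita ℂ) : LeviCivita ℝ :=
  ∑ i, (re (x i) ^ 2 + im (x i) ^ 2)

theorem norm2_eq_sqrt_normSq {n : ℕ} (x : Fin n → LeviCivita ℂ) : norm2 x = sqrt (normSq x) := by
  simp only [norm2, normSq, abs_sq]

theorem normSq_nonneg {n : ℕ} (x : Fin n → LeviCivita ℂ) : normSq x = 0 ∨ IsPos (normSq x) :=
  sum_sq_add_sq_nonneg _ _ _

/-- `ofReal` as a ring homomorphism. -/
noncomputable def ofRealHom : LeviCivita ℝ →+* LeviCivita ℂ where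
  toFun := ofReal
  map_zero' := Subtype.ext (HahnSeries.ext (funext fun _ => Complex.ofReal_zero))
  map_one' := Subtype.ext (HahnSeries.map_one Complex.ofRealHom.toMonoidWithZeroHom)
  map_add' _ _ := Subtype.ext (HahnSeries.map_add (Complex.ofRealHom : ℝ →+ ℂ))
  map_mul' _ _ := Subtype.ext (HahnSeries.map_mul (Complex.ofRealHom : ℝ →ₙ+* ℂ))

theorem ofRealHom_apply (a : LeviCivita ℝ) : ofRealHom a = ofReal a := rfl

theorem coe_ofReal (a : LeviCivita ℝ) :
    (ofReal a).1 = a.1.map (Complex.ofRealHom : ℝ →+ ℂ) := rfl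

theorem re_ofReal_mul (c : LeviCivita ℝ) (z : LeviCivita ℂ) : re (ofReal c * z) = c * re z := by
  refine Subtype.ext (HahnSeries.ext (funext fun q => ?_))
  change (((ofReal c).1 * z.1).coeff q).re = (c.1 * (re z).1).coeff q
  rw [HahnSeries.coeff_mul_of_support_subset c.2.isPWO z.2.isPWO _ subset_rfl,
    HahnSeries.coeff_mul_of_support_subset c.2.isPWO z.2.isPWO subset_rfl, Complex.re_sum]
  · simp [ofReal, re]
  · intro q hq h; exact hq (by simp [re, h])
  · intro q hq h; exact hq (by simp [ofReal, h])

theorem im_ofReal_mul (c : LeviCivita ℝ) (z : LeviCivita ℂ) : im (ofReal c * z) = c * im z := by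
  refine Subtype.ext (HahnSeries.ext (funext fun q => ?_))
  change (((ofReal c).1 * z.1).coeff q).im = (c.1 * (im z).1).coeff q
  rw [HahnSeries.coeff_mul_of_support_subset c.2.isPWO z.2.isPWO _ subset_rfl,
    HahnSeries.coeff_mul_of_support_subset c.2.isPWO z.2.isPWO subset_rfl, Complex.im_sum]
  · simp [ofReal, im]
  · intro q hq h; exact hq (by simp [im, h])
  · intro q hq h; exact hq (by simp [ofReal, h])

theorem normSq_smul {n : ℕ} (c : LeviCivita ℝ) (x : Fin n → LeviCivita ℂ) :
    normSq (ofReal c • x) = c * c * normSq x := by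
  simp only [normSq, Pi.smul_apply, smul_eq_mul, re_ofReal_mul, im_ofReal_mul, Finset.mul_sum]
  exact Finset.sum_congr rfl fun i _ => by ring

theorem norm2_smul {n : ℕ} {c : LeviCivita ℝ} (hc : IsPos c) (x : Fin n → LeviCivita ℂ) :
    norm2 (ofReal c • x) = c * norm2 x := by
  obtain ⟨h1, h2⟩ := sqrt_spec (normSq_nonneg x)
  rw [norm2_eq_sqrt_normSq, norm2_eq_sqrt_normSq, normSq_smul]
  refine sqrt_eq ?_ ?_
  · exact h1.imp (fun h => by rw [h, mul_zero]) hc.mul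
  · rw [mul_mul_mul_comm, h2]

theorem inv_norm2_smul_smul {n : ℕ} {c : LeviCivita ℝ} (hc : IsPos c)
    (x : Fin n → LeviCivita ℂ) :
    (ofReal (norm2 (ofReal c • x)))⁻¹ • (ofReal c • x) = (ofReal (norm2 x))⁻¹ • x := by
  have hc0 : ofReal c ≠ 0 := (map_ne_zero ofRealHom).2 hc.ne_zero
  rw [norm2_smul hc, ← ofRealHom_apply (c * _), map_mul, ofRealHom_apply, ofRealHom_apply,
    smul_smul, mul_inv_rev, mul_assoc, inv_mul_cancel₀ hc0, mul_one]

/-- This links the norm, defined by choosing a root, to the explicit series `rsqrt`, for which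
convergence is known. -/
theorem coe_inv_norm2 {n : ℕ} {x : Fin n → LeviCivita ℂ} (h : 0 ≤ (normSq x).1.orderTop)
    (h0 : 0 < (normSq x).1.coeff 0) : ((norm2 x)⁻¹).1 = HahnSeries.rsqrt (normSq x).1 := by
  have hf := ((HahnSeries.CoeffTendsto.const (normSq x).2 h).rsqrt h0).leftFinite_support
  have hmul := HahnSeries.rsqrt_mul_rsqrt_mul h h0
  let g : LeviCivita ℝ := ⟨HahnSeries.rsqrt (normSq x).1, hf⟩
  have hg : IsPos g := HahnSeries.leadingCoeff_rsqrt_pos (normSq x).2 h h0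
  have hgm : g * g * normSq x = 1 := Subtype.ext hmul
  have hM : IsPos (normSq x) := (normSq_nonneg x).resolve_left fun h => by
    rw [h, mul_zero] at hgm; exact zero_ne_one hgm
  have hs : norm2 x = g * normSq x := by
    rw [norm2_eq_sqrt_normSq]
    refine sqrt_eq (Or.inr (hg.mul hM)) ?_
    calc g * normSq x * (g * normSq x) = g * g * normSq x * normSq x := by ring
      _ = normSq x := by rw [hgm, one_mul]
  have : (norm2 x)⁻¹ = g := by
    refine inv_eq_of_mul_eq_one_left ?_
    rw [hs, ← hgm, mul_assoc]
  rw [this]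

theorem coeffTendsto_normSq {n : ℕ} {y : ℕ → Fin n → LeviCivita ℂ} {l : Fin n → LeviCivita ℂ}
    (h : ∀ i, HahnSeries.CoeffTendsto (fun k => (y k i).1) (l i).1) :
    HahnSeries.CoeffTendsto (fun k => (normSq (y k)).1) (normSq l).1 := by
  have hcoe : ∀ x : Fin n → LeviCivita ℂ, (normSq x).1
      = ∑ i, ((x i).1.map Complex.reAddGroupHom ^ 2 + (x i).1.map Complex.imAddGroupHom ^ 2) := by
    intro x
    rw [normSq, ← Subfield.subtype_apply, map_sum]
    rfl
  simp only [hcoe]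
  exact .sum _ fun i _ => (((h i).map _ Complex.continuous_re).pow 2).add
    (((h i).map _ Complex.continuous_im).pow 2)

/-- The constant coefficient is the sum of the `|x i [0]| ^ 2`, where nothing can cancel. -/
theorem coeff_zero_normSq_pos {n : ℕ} {x : Fin n → LeviCivita ℂ} (hx : ∀ i, AtMostFinite (x i))
    (h0 : ∃ i, coeff (x i) 0 ≠ 0) : 0 < (normSq x).1.coeff 0 := by
  have hre : ∀ i, 0 ≤ (re (x i)).1.orderTop := fun i =>
    HahnSeries.zero_le_orderTop_iff_support.2 fun q hq =>
      HahnSeries.zero_le_orderTop_iff_support.1 (hx i) q fun h => hq (by simp [re, h])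
  have him : ∀ i, 0 ≤ (im (x i)).1.orderTop := fun i =>
    HahnSeries.zero_le_orderTop_iff_support.2 fun q hq =>
      HahnSeries.zero_le_orderTop_iff_support.1 (hx i) q fun h => hq (by simp [im, h])
  have hcoe : (normSq x).1.coeff 0 = ∑ i, Complex.normSq (coeff (x i) 0) := by
    rw [normSq, ← Subfield.subtype_apply, map_sum, HahnSeries.coeff_sum]
    refine Finset.sum_congr rfl fun i _ => ?_
    rw [map_add, map_pow, map_pow, HahnSeries.coeff_add, sq, sq, Subfield.subtype_apply,
      Subfield.subtype_apply, HahnSeries.coeff_zero_mul (hre i) (hre i),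
      HahnSeries.coeff_zero_mul (him i) (him i), Complex.normSq_apply]
    rfl
  rw [hcoe]
  obtain ⟨i, hi⟩ := h0
  exact Finset.sum_pos' (fun i _ => Complex.normSq_nonneg _)
    ⟨i, Finset.mem_univ i, Complex.normSq_pos.2 hi⟩

/-! ### Weak convergence of normalized vectors and of eigenvalue quotients -/

/-- Only finitely many exponents of the common support lie below a given bound, so coefficientwise
convergence is uniform there. -/
theorem weakTendsto_of_coeffTendsto {a : ℕ → LeviCivita ℂ} {l : LeviCivita ℂ}
    (h : HahnSeries.CoeffTendsto (fun k => (a k).1) l.1) : WeakTendsto a l := by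
  obtain ⟨s, hs, -, ha, hl⟩ := h
  intro r hr
  have hls := HahnSeries.CoeffTendsto.support_subset_of_eventually ha hl
  obtain ⟨R, hR⟩ := exists_rat_gt (1 / r)
  -- A supremum preserves only weak inequalities; `r / 2` leaves room for the strict one.
  have hev : ∀ᶠ k in atTop, ∀ q ∈ {q ∈ s | q < R}, ‖(a k).1.coeff q - l.1.coeff q‖ < r / 2 := by
    rw [(hs R).eventually_all]
    intro q _
    have := ((hl q).sub_const (l.1.coeff q)).norm
    rw [sub_self, norm_zero] at this
    exact this.eventually_lt_const (half_pos hr)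
  obtain ⟨N, hN⟩ := eventually_atTop.1 (hev.and ha)
  refine ⟨N, fun k hk => ?_⟩
  obtain ⟨h1, h2⟩ := hN k hk.le
  refine lt_of_le_of_lt (Real.iSup_le (fun q => ?_) (half_pos hr).le) (half_lt_self hr)
  change ‖(a k).1.coeff q.1 - l.1.coeff q.1‖ ≤ r / 2
  by_cases hq : q.1 ∈ s
  · exact (h1 _ ⟨hq, by exact_mod_cast q.2.trans_lt hR⟩).le
  · rw [not_not.1 fun h => hq (h2 h), not_not.1 fun h => hq (hls h), sub_zero, norm_zero]
    exact (half_pos hr).le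

theorem vecWeakTendsto_normalize {n : ℕ} {y : ℕ → Fin n → LeviCivita ℂ}
    {l : Fin n → LeviCivita ℂ}
    (h : ∀ i, HahnSeries.CoeffTendsto (fun k => (y k i).1) (l i).1)
    (h0 : ∃ i, coeff (l i) 0 ≠ 0) :
    VecWeakTendsto (fun k => (ofReal (norm2 (y k)))⁻¹ • y k) ((ofReal (norm2 l))⁻¹ • l) := by
  have hM := coeffTendsto_normSq h
  have hM0 := coeff_zero_normSq_pos (fun i => (h i).zero_le_orderTop) h0
  have hinv : HahnSeries.CoeffTendsto (fun k => ((norm2 (y k))⁻¹).1) ((norm2 l)⁻¹).1 := by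
    rw [coe_inv_norm2 hM.zero_le_orderTop hM0]
    refine (hM.rsqrt hM0).congr' ?_
    filter_upwards [hM.eventually_zero_le_orderTop,
      (hM.tendsto_coeff 0).eventually_const_lt hM0] with k h1 h2
    rw [coe_inv_norm2 h1 h2]
  intro i
  refine weakTendsto_of_coeffTendsto ?_
  simp only [Pi.smul_apply, smul_eq_mul, Subfield.coe_mul, ← ofRealHom_apply, ← map_inv₀]
  simp only [ofRealHom_apply, coe_ofReal]
  exact (hinv.map _ Complex.continuous_ofReal).mul (h i)

theorem coeffTendsto_pow_div_zero {a b : LeviCivita ℝ} (ha : AtMostFinite a) (hb : AtMostFinite b)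
    (hb1 : coeff b 0 = 1) (h : |coeff a 0| < 1) :
    HahnSeries.CoeffTendsto (fun k => (ofReal ((a / b) ^ k)).1) 0 := by
  have hb0 : b ≠ 0 := by rintro rfl; simp [coeff] at hb1
  have hbo : b.1.orderTop = 0 :=
    HahnSeries.orderTop_eq_zero hb (by change coeff b 0 ≠ 0; rw [hb1]; exact one_ne_zero)
  have hab : (a / b).1 * b.1 = a.1 := by rw [← Subfield.coe_mul, div_mul_cancel₀ a hb0]
  have hd : 0 ≤ (a / b).1.orderTop := by
    have : a.1.orderTop = (a / b).1.orderTop := by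
      rw [← hab, HahnSeries.orderTop_mul, hbo, add_zero]
    rw [← this]; exact ha
  have hc : (a / b).1.coeff 0 = coeff a 0 := by
    have := HahnSeries.coeff_zero_mul hd hb
    rw [hab] at this
    change coeff a 0 = _ * coeff b 0 at this
    rw [this, hb1, mul_one]
  have key := HahnSeries.CoeffTendsto.pow_zero (a / b).2 hd (by rwa [hc, Real.norm_eq_abs])
  have := key.map (Complex.ofRealHom : ℝ →+ ℂ) Complex.continuous_ofReal
  rwa [show (0 : HahnSeries ℚ ℝ).map (Complex.ofRealHom : ℝ →+ ℂ) = 0 from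
    HahnSeries.ext (funext fun _ => Complex.ofReal_zero)] at this

end LeviCivita

/-! ### Power iteration -/

theorem Matrix.pow_mulVec_of_eigenvector {ι R : Type*} [Fintype ι] [DecidableEq ι] [CommRing R]
    {A : Matrix ι ι R} {v : ι → R} {c : R} (h : A.mulVec v = c • v) (k : ℕ) :
    (A ^ k).mulVec v = c ^ k • v := by
  induction k with
  | zero => simp
  | succ k ih =>
    rw [pow_succ, ← Matrix.mulVec_mulVec, h, Matrix.mulVec_smul, ih, smul_smul, pow_succ']

theorem theorem4p3 {n : ℕ} [NeZero n]
    (A : Matrix (Fin n) (Fin n) (LeviCivita ℂ)) (ν : Fin n → LeviCivita ℝ)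
    (hA : LeviCivita.IsDiagonalizableWith A (fun j => LeviCivita.ofReal (ν j)))
    (hfin : ∀ j, LeviCivita.AtMostFinite (ν j))
    (hν₁ : LeviCivita.coeff (ν 0) 0 = 1)
    (hlt : ∀ j, j ≠ 0 → |LeviCivita.coeff (ν j) 0| < 1)
    (hanti : Antitone fun j => |LeviCivita.coeff (ν j) 0|)
    (x : Fin n → LeviCivita ℂ) (w : Fin n → Fin n → LeviCivita ℂ)
    (hx : x = ∑ j, w j)
    (hw : ∀ j, A.mulVec (w j) = LeviCivita.ofReal (ν j) • w j)
    (hwfin : ∀ j i, LeviCivita.AtMostFinite (w j i))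
    (hw₁ : ∃ i, LeviCivita.coeff (w 0 i) 0 ≠ 0) :
    LeviCivita.VecWeakTendsto
      (fun k => (LeviCivita.ofReal (LeviCivita.norm2 ((A ^ k).mulVec x)))⁻¹ • (A ^ k).mulVec x)
      ((LeviCivita.ofReal (LeviCivita.norm2 (w 0)))⁻¹ • w 0) := by
  have hpos : LeviCivita.IsPos (ν 0) := by
    have h0 : (ν 0).1.coeff 0 = 1 := hν₁
    rw [LeviCivita.IsPos, HahnSeries.leadingCoeff_eq_coeff_zero (hfin 0) (by simp [h0]), h0]
    exact one_pos
  -- The iterate with its dominant factor `ν 0 ^ k` removed; all its terms stay at most finite.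
  let y : ℕ → Fin n → LeviCivita ℂ := fun k =>
    ∑ j, LeviCivita.ofReal ((ν j / ν 0) ^ k) • w j
  have hAx : ∀ k, (A ^ k).mulVec x = LeviCivita.ofReal (ν 0 ^ k) • y k := fun k => by
    rw [hx, Matrix.mulVec_sum, Finset.smul_sum]
    refine Finset.sum_congr rfl fun j _ => ?_
    rw [Matrix.pow_mulVec_of_eigenvector (hw j), smul_smul]
    simp only [← LeviCivita.ofRealHom_apply]
    rw [← map_mul, ← map_pow, ← mul_pow, mul_div_cancel₀ _ hpos.ne_zero]
  simp only [hAx, LeviCivita.inv_norm2_smul_smul (hpos.pow _)]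
  refine LeviCivita.vecWeakTendsto_normalize (fun i => ?_) hw₁
  have hterm : ∀ j, HahnSeries.CoeffTendsto
      (fun k => (LeviCivita.ofReal ((ν j / ν 0) ^ k)).1 * (w j i).1)
      (if j = 0 then (w 0 i).1 else 0) := fun j => by
    have hwc := HahnSeries.CoeffTendsto.const (w j i).2 (hwfin j i)
    split_ifs with hj
    · subst hj
      refine hwc.congr' (.of_forall fun k => ?_)
      rw [div_self hpos.ne_zero, one_pow, ← LeviCivita.ofRealHom_apply, map_one]
      simp
    · simpa using (LeviCivita.coeffTendsto_pow_div_zero (hfin j) (hfin 0) hν₁ (hlt j hj)).mul hwc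
  have hsum := HahnSeries.CoeffTendsto.sum Finset.univ fun j _ => hterm j
  rw [Finset.sum_ite_eq' Finset.univ 0, if_pos (Finset.mem_univ _)] at hsum
  refine hsum.congr' (.of_forall fun k => ?_)
  simp only [y, Finset.sum_apply, Pi.smul_apply, smul_eq_mul]
  rw [← Subfield.subtype_apply, map_sum]
  rfl
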